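/- **Theorem (Runtime of the MMAHH).** For $n \ge 1$ and $x \in \{0,1\}^n$ let $x^* = (1,\dots,1)$ and let $L_h = \{x \in \{0,1\}^n : n - \|x\|_1 = h\}$ be the set of bit strings at Hamming distance $h$ from $x^*$. For integers $n \ge 2$, $0 \le k \le n-2$ and $n = d_0 > d_1 > \dots > d_k > d_{k+1} = 0$, let $\mathrm{SEQOPT}_k(d_1,\dots,d_k)$ be the set of all $f : \{0,1\}^n \to \mathbb{R}$ such that $x^*$ is the unique global maximum of $f$ and, for every $\ell \in \{0,\dots,k\}$, every $h$ with $d_{\ell+1} \le h < d_\ell$, every $x \in L_h$ and every $y \in L_{h+1}$, one has $f(x) > f(y)$ if $k-\ell$ is even and $f(x) < f(y)$ if $k - \ell$ is odd. The Markov move-acceptance hyper-heuristic (MMAHH) with switching probabilities $p,q\in(0,1)$ on $f : \{0,1\}^n \to \mathbb{R}$ is the random process $(x_t,s_t)_{t\ge 0}$ in $\{0,1\}^n\times\{\mathrm{OI},\mathrm{OW}\}$ in which $x_0$ is uniform on $\{0,1\}^n$, $s_0=\mathrm{OI}$, and in each iteration $t$: a string $x'$ is obtained from $x_t$ by flipping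 one uniformly chosen bit; $x_{t+1}=x'$ if ($s_t=\mathrm{OI}$ and $f(x')>f(x_t)$) or ($s_t=\mathrm{OW}$ and $f(x')<f(x_t)$), and $x_{t+1}=x_t$ otherwise; independently, $s_{t+1}\neq s_t$ with probability $p$ if $s_t=\mathrm{OI}$ and with probability $q$ if $s_t=\mathrm{OW}$, and $s_{t+1}=s_t$ otherwise. Its runtime is $T=\inf\{t\ge 0 : x_t=x^*\}$. Suppose that $p, q = \Theta\!\left(\frac{1}{n\log n}\right)$ and $k=O(1)$ as $n\to\infty$. Then, uniformly over all $f \in \mathrm{SEQOPT}_k(d_1,\dots,d_k)$, the expected runtime of the MMAHH on $f$ satisfies $$\mathrm{E}[T] = O\!\left(\frac{n^{k+1}}{d_1\cdots d_k}\,\log n\right).$$ That is: for all $K\in\mathbb{N}$ and $c_1,c_2>0$ there are $C>0$ and $N\in\mathbb{N}$ such that for all $n\ge N$, all $p,q\in(0,1)$ with $\frac{c_1}{n\log n}\le p,q\le \frac{c_2}{n\log n}$, all $k\le K$, all $n>d_1>\dots>d_k>0$ with $k\le n-2$ and all $f\in \mathrm{SEQOPT}_k(d_1,\dots,d_k)$,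 one has $\mathrm{E}[T]\le C\,\frac{n^{k+1}}{d_1\cdots d_k}\log n$. -/

import Mathlib

open MeasureTheory

/-- Bit strings of length `n`. -/
abbrev BitString (n : ℕ) : Type := Fin n → Bool

/-- The all-ones string `x* = (1, …, 1)`. -/
def allOnes (n : ℕ) : BitString n := fun _ => true

/-- The `h`-th layer: the bit strings at Hamming distance `h` from `x*`. -/
def layer (n h : ℕ) : Set (BitString n) := {x | hammingDist x (allOnes n) = h}

/-- `f` is increasing between layer `h + 1` and layer `h` (that is, towards `x*`). -/
def IncreasingAt {n : ℕ} (f : BitString n → ℝ) (h : ℕ) : Prop :=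
  ∀ x ∈ layer n h, ∀ y ∈ layer n (h + 1), f y < f x

/-- `f` is decreasing between layer `h + 1` and layer `h` (that is, towards `x*`). -/
def DecreasingAt {n : ℕ} (f : BitString n → ℝ) (h : ℕ) : Prop :=
  ∀ x ∈ layer n h, ∀ y ∈ layer n (h + 1), f x < f y

/-- `f ∈ SEQOPT_k(d₁, …, d_k)`, where `d 0 = n > d 1 > ⋯ > d k > d (k + 1) = 0`
(the values of `d` beyond `k + 1` play no role). -/
structure SeqOpt (n k : ℕ) (d : ℕ → ℕ) (f : BitString n → ℝ) : Prop where
  two_le : 2 ≤ n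
  le_sub_two : k ≤ n - 2
  d_zero : d 0 = n
  d_last : d (k + 1) = 0
  d_lt : ∀ l ≤ k, d (l + 1) < d l
  unique_max : ∀ x, x ≠ allOnes n → f x < f (allOnes n)
  increasing : ∀ l ≤ k, Even (k - l) → ∀ h, d (l + 1) ≤ h → h < d l → IncreasingAt f h
  decreasing : ∀ l ≤ k, Odd (k - l) → ∀ h, d (l + 1) ≤ h → h < d l → DecreasingAt f h

/-- The two acceptance operators: only-improving and only-worsening. -/
inductive AcceptOp : Type
  | OI
  | OW
  deriving DecidableEq

instance : Fintype AcceptOp := ⟨{AcceptOp.OI, AcceptOp.OW}, fun s => by cases s <;> simp⟩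

instance : MeasurableSpace AcceptOp := ⊤

/-- Acceptance of a move from a solution of value `a` to a solution of value `b`. -/
def AcceptOp.Accepts : AcceptOp → ℝ → ℝ → Prop
  | .OI, a, b => a < b
  | .OW, a, b => b < a

/-- Flip the `v`-th bit of `x`. -/
def flipBit {n : ℕ} (x : BitString n) (v : Fin n) : BitString n :=
  Function.update x v (!x v)

open Classical in
/-- The next solution if the `v`-th bit is chosen to be flipped while operator `s` is in use. -/
noncomputable def nextSolution {n : ℕ} (f : BitString n → ℝ) (s : AcceptOp) (x : BitString n)
    (v : Fin n) : BitString n :=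
  if s.Accepts (f x) (f (flipBit x v)) then flipBit x v else x

/-- Probability that the next solution is `y` if the current one is `x`, the current operator is
`s`, and the flipped bit is chosen uniformly at random. -/
noncomputable def moveProb {n : ℕ} (f : BitString n → ℝ) (s : AcceptOp) (x y : BitString n) : ℝ :=
  (Finset.univ.filter fun v : Fin n => nextSolution f s x v = y).card / n

/-- Transition probabilities of the two-state chain that selects the operators. -/
def switchProb (p q : ℝ) : AcceptOp → AcceptOp → ℝ
  | .OI, .OI => 1 - p
  | .OI, .OW => p
  | .OW, .OW => 1 - q
  | .OW, .OI => q

/-- The random sequence `(X t, S t)` of solutions and operators is a run of the MMAHH on `f` with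
switching probabilities `p` (from OI to OW) and `q` (from OW to OI): `X 0` is uniform, `S 0 = OI`,
and given the history up to time `t`, the next solution and the next operator are drawn
independently of each other with the probabilities `moveProb` and `switchProb`. -/
structure IsMMAHHRun {n : ℕ} (p q : ℝ) (f : BitString n → ℝ) {Ω : Type*} [MeasurableSpace Ω]
    (μ : Measure Ω) (X : ℕ → Ω → BitString n) (S : ℕ → Ω → AcceptOp) : Prop where
  measurable_X : ∀ t, Measurable (X t)
  measurable_S : ∀ t, Measurable (S t)
  initial : ∀ x, μ.real {ω | X 0 ω = x ∧ S 0 ω = AcceptOp.OI} = 1 / 2 ^ n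
  step : ∀ (t : ℕ) (x : ℕ → BitString n) (s : ℕ → AcceptOp),
    μ.real {ω | ∀ i ≤ t + 1, X i ω = x i ∧ S i ω = s i} =
      μ.real {ω | ∀ i ≤ t, X i ω = x i ∧ S i ω = s i} *
        (moveProb f (s t) (x t) (x (t + 1)) * switchProb p q (s t) (s (t + 1)))

/-- The runtime `T = inf {t ≥ 0 | x_t = x*}`, with `T = ∞` if `x*` is never reached. -/
noncomputable def runtime {n : ℕ} {Ω : Type*} (X : ℕ → Ω → BitString n) (ω : Ω) : ℕ∞ :=
  ⨅ (t : ℕ) (_ : X t ω = allOnes n), (t : ℕ∞)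

/-- The expected runtime `E[T] ∈ [0, ∞]`. -/
noncomputable def expectedRuntime {n : ℕ} {Ω : Type*} [MeasurableSpace Ω] (μ : Measure Ω)
    (X : ℕ → Ω → BitString n) : ENNReal :=
  ∫⁻ ω, (runtime X ω : ENNReal) ∂μ

/-!
Only the distance `h` to the optimum and the operator in use matter. Except at the turning
distances, the right operator can only move closer to the optimum and needs `n / h` steps in
expectation to do so. As the switching rates are `O(1 / (n log n))`, it is switched before that with
probability `O(1 / (h log n))`, and by the growth of the harmonic sum these failures cost only a
constant factor altogether. At a turning distance `d`, the process halts until the operator is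
switched, and then the next move is towards the optimum with probability `d / n`. Hence an attempt
lasts `O(n log n)` steps and succeeds with a probability of order `A = ∏ d / n`, the product being
over the turning distances. Additive drift makes this precise: a potential with values in `[0, 1]`
increases in expectation by at least `ρ A` per step, where `ρ` bounds the switching rates from
below, because a wrong operator is replaced by a right one with probability at least `ρ`.
-/

section MarkovChain

variable {Ω α : Type*}

/-- The first `t + 1` values of the process `Z`. -/
def history (Z : ℕ → Ω → α) (t : ℕ) (ω : Ω) : Fin (t + 1) → α := fun i => Z i ω

/-- The event that the process `Z` stays outside `B` up to time `t`. -/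
def avoidSet (Z : ℕ → Ω → α) (B : Set α) (t : ℕ) : Set Ω := {ω | ∀ i ≤ t, Z i ω ∉ B}

theorem avoidSet_eq_preimage_history (Z : ℕ → Ω → α) (B : Set α) (t : ℕ) :
    avoidSet Z B t = history Z t ⁻¹' {h | ∀ i, h i ∉ B} := by
  ext ω
  exact ⟨fun h i => h i (Nat.le_of_lt_succ i.2), fun h i hi => h ⟨i, Nat.lt_succ_of_le hi⟩⟩

theorem avoidSet_antitone (Z : ℕ → Ω → α) (B : Set α) : Antitone (avoidSet Z B) :=
  fun _ _ hst _ h i hi => h i (hi.trans hst)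

variable [MeasurableSpace Ω] [MeasurableSpace α]

theorem measurable_history {Z : ℕ → Ω → α} (hZ : ∀ t, Measurable (Z t)) (t : ℕ) :
    Measurable (history Z t) :=
  measurable_pi_lambda _ fun i => hZ i

theorem measurableSet_avoidSet {Z : ℕ → Ω → α} (hZ : ∀ t, Measurable (Z t)) {B : Set α}
    (hB : MeasurableSet B) (t : ℕ) : MeasurableSet (avoidSet Z B t) := by
  simp only [avoidSet, Set.ofPred_forall]
  exact .iInter fun i => .iInter fun _ => hZ i hB.compl

/-- `Z` is a Markov chain with transition matrix `P` under `μ`, expressed through the probabilities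
of finite histories. The initial law is arbitrary. -/
structure IsMarkovChain (P : α → α → ℝ) (μ : Measure Ω) (Z : ℕ → Ω → α) : Prop where
  measurable : ∀ t, Measurable (Z t)
  step : ∀ (t : ℕ) (z : ℕ → α), μ.real {ω | ∀ i ≤ t + 1, Z i ω = z i} =
    μ.real {ω | ∀ i ≤ t, Z i ω = z i} * P (z t) (z (t + 1))

theorem integral_comp_eq_sum {β : Type*} [Fintype β] [MeasurableSpace β]
    [MeasurableSingletonClass β] (μ : Measure Ω) [IsFiniteMeasure μ] {Y : Ω → β}
    (hY : Measurable Y) (G : β → ℝ) :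
    ∫ ω, G (Y ω) ∂μ = ∑ y, μ.real (Y ⁻¹' {y}) * G y := by
  rw [← integral_map hY.aemeasurable (measurable_of_finite G).aestronglyMeasurable,
    integral_fintype .of_finite]
  simp only [map_measureReal_apply hY (measurableSet_singleton _), smul_eq_mul]

namespace IsMarkovChain

variable {P : α → α → ℝ} {μ : Measure Ω} {Z : ℕ → Ω → α} {B : Set α} {V : α → ℝ} {δ : ℝ}

theorem measureReal_history_snoc (hZ : IsMarkovChain P μ Z) (t : ℕ) (h : Fin (t + 1) → α) (b : α) :
    μ.real (history Z (t + 1) ⁻¹' {Fin.snoc h b}) =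
      μ.real (history Z t ⁻¹' {h}) * P (h (Fin.last t)) b := by
  set z : ℕ → α := fun i => if hi : i < t + 1 then h ⟨i, hi⟩ else b
  have hzh : ∀ i : Fin (t + 1), z i = h i := fun i => dif_pos i.2
  have hzb : z (t + 1) = b := dif_neg (lt_irrefl _)
  have hpre : history Z t ⁻¹' {h} = {ω | ∀ i ≤ t, Z i ω = z i} := by
    ext ω
    simp [history, funext_iff, ← hzh, Fin.forall_iff]
  have hpre_succ : history Z (t + 1) ⁻¹' {Fin.snoc h b} = {ω | ∀ i ≤ t + 1, Z i ω = z i} := by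
    have hsnoc : ∀ i : Fin (t + 2), (Fin.snoc h b : Fin (t + 2) → α) i = z i := fun i => by
      cases i using Fin.lastCases <;> simp [hzh, hzb]
    ext ω
    simp [history, funext_iff, hsnoc, Fin.forall_iff]
  rw [hpre, hpre_succ, hZ.step, hzb, ← hzh (Fin.last t), Fin.val_last]

variable [MeasurableSingletonClass α]

theorem integrable_comp [Finite α] [IsFiniteMeasure μ] (hZ : IsMarkovChain P μ Z) (V : α → ℝ)
    (t : ℕ) : Integrable (fun ω => V (Z t ω)) μ :=
  Integrable.of_finite.comp_measurable (hZ.measurable t)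

variable [Fintype α]

theorem integral_history_succ [IsFiniteMeasure μ] (hZ : IsMarkovChain P μ Z) (t : ℕ)
    (G : (Fin (t + 1) → α) → α → ℝ) :
    ∫ ω, G (history Z t ω) (Z (t + 1) ω) ∂μ =
      ∫ ω, ∑ b, P (Z t ω) b * G (history Z t ω) b ∂μ := by
  calc ∫ ω, G (history Z t ω) (Z (t + 1) ω) ∂μ
      = ∑ h', μ.real (history Z (t + 1) ⁻¹' {h'}) * G (Fin.init h') (h' (Fin.last (t + 1))) :=
        integral_comp_eq_sum μ (measurable_history hZ.measurable (t + 1))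
          fun h' => G (Fin.init h') (h' (Fin.last (t + 1)))
    _ = ∑ h, ∑ b, μ.real (history Z (t + 1) ⁻¹' {Fin.snoc h b}) * G h b := by
        rw [← (Fin.snocEquiv fun _ => α).sum_comp, Fintype.sum_prod_type_right]
        simp [Fin.snocEquiv]
    _ = ∑ h, μ.real (history Z t ⁻¹' {h}) * ∑ b, P (h (Fin.last t)) b * G h b := by
        simp only [hZ.measureReal_history_snoc, Finset.mul_sum, mul_assoc]
    _ = ∫ ω, ∑ b, P (Z t ω) b * G (history Z t ω) b ∂μ :=
        (integral_comp_eq_sum μ (measurable_history hZ.measurable t)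
          fun h => ∑ b, P (h (Fin.last t)) b * G h b).symm

theorem setIntegral_avoidSet_succ [IsFiniteMeasure μ] (hZ : IsMarkovChain P μ Z) (B : Set α)
    (V : α → ℝ) (t : ℕ) :
    ∫ ω in avoidSet Z B t, V (Z (t + 1) ω) ∂μ =
      ∫ ω in avoidSet Z B t, ∑ b, P (Z t ω) b * V b ∂μ := by
  classical
  have hA := measurableSet_avoidSet hZ.measurable (Set.toFinite B).measurableSet t
  have h := hZ.integral_history_succ t fun h b => if ∀ i, h i ∉ B then V b else 0
  simp only [← integral_indicator hA]
  simpa only [avoidSet_eq_preimage_history, Set.indicator_apply, Set.mem_preimage,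
    Set.mem_ofPred_eq, mul_ite, mul_zero, Finset.sum_ite_irrel, Finset.sum_const_zero] using h

theorem setIntegral_avoidSet_succ_le [IsFiniteMeasure μ] (hZ : IsMarkovChain P μ Z)
    (hV : ∀ a, 0 ≤ V a) (hdrift : ∀ a ∉ B, ∑ b, P a b * V b ≤ V a - δ) (t : ℕ) :
    ∫ ω in avoidSet Z B (t + 1), V (Z (t + 1) ω) ∂μ ≤
      ∫ ω in avoidSet Z B t, V (Z t ω) ∂μ - δ * μ.real (avoidSet Z B t) := by
  have hA := measurableSet_avoidSet hZ.measurable (Set.toFinite B).measurableSet t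
  calc ∫ ω in avoidSet Z B (t + 1), V (Z (t + 1) ω) ∂μ
      ≤ ∫ ω in avoidSet Z B t, V (Z (t + 1) ω) ∂μ :=
        setIntegral_mono_set (hZ.integrable_comp V (t + 1)).integrableOn
          (ae_of_all _ fun ω => hV (Z (t + 1) ω))
          (avoidSet_antitone Z B t.le_succ).eventuallyLE
    _ = ∫ ω in avoidSet Z B t, ∑ b, P (Z t ω) b * V b ∂μ := hZ.setIntegral_avoidSet_succ B V t
    _ ≤ ∫ ω in avoidSet Z B t, (V (Z t ω) - δ) ∂μ :=
        setIntegral_mono_on (hZ.integrable_comp (fun a => ∑ b, P a b * V b) t).integrableOn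
          ((hZ.integrable_comp V t).sub (integrable_const δ)).integrableOn hA
          fun ω hω => hdrift _ (hω t le_rfl)
    _ = ∫ ω in avoidSet Z B t, V (Z t ω) ∂μ - δ * μ.real (avoidSet Z B t) := by
        rw [integral_sub (hZ.integrable_comp V t).integrableOn (integrable_const δ),
          setIntegral_const, smul_eq_mul, mul_comm]

/-- The additive drift theorem of He and Yao; the left-hand side is the expected hitting time
of `B`. -/
theorem tsum_measure_avoidSet_le [IsFiniteMeasure μ] (hZ : IsMarkovChain P μ Z)
    (hV : ∀ a, 0 ≤ V a) (hδ : 0 < δ) (hdrift : ∀ a ∉ B, ∑ b, P a b * V b ≤ V a - δ) :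
    ∑' t, μ (avoidSet Z B t) ≤ ENNReal.ofReal ((∫ ω, V (Z 0 ω) ∂μ) / δ) := by
  have htelescope : ∀ m, δ * ∑ t ∈ Finset.range m, μ.real (avoidSet Z B t) ≤
      ∫ ω in avoidSet Z B 0, V (Z 0 ω) ∂μ - ∫ ω in avoidSet Z B m, V (Z m ω) ∂μ := by
    intro m
    induction m with
    | zero => simp
    | succ m ih =>
      rw [Finset.sum_range_succ, mul_add]
      linarith [hZ.setIntegral_avoidSet_succ_le hV hdrift m]
  have hinit : ∫ ω in avoidSet Z B 0, V (Z 0 ω) ∂μ ≤ ∫ ω, V (Z 0 ω) ∂μ :=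
    setIntegral_le_integral (hZ.integrable_comp V 0) (ae_of_all _ fun ω => hV (Z 0 ω))
  refine ENNReal.tsum_le_of_sum_range_le fun m => ?_
  calc ∑ t ∈ Finset.range m, μ (avoidSet Z B t)
      = ENNReal.ofReal (∑ t ∈ Finset.range m, μ.real (avoidSet Z B t)) := by
        rw [ENNReal.ofReal_sum_of_nonneg fun t _ => measureReal_nonneg]
        exact Finset.sum_congr rfl fun t _ => (ofReal_measureReal).symm
    _ ≤ ENNReal.ofReal ((∫ ω, V (Z 0 ω) ∂μ) / δ) := by
        refine ENNReal.ofReal_le_ofReal ((le_div_iff₀' hδ).2 ((htelescope m).trans ?_))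
        have hfinal : 0 ≤ ∫ ω in avoidSet Z B m, V (Z m ω) ∂μ :=
          integral_nonneg fun ω => hV (Z m ω)
        linarith

end IsMarkovChain

end MarkovChain

section Runtime

variable {n : ℕ} {Ω : Type*} (X : ℕ → Ω → BitString n)

theorem lt_runtime_iff (ω : Ω) (t : ℕ) :
    (t : ℕ∞) < runtime X ω ↔ ω ∈ avoidSet X {allOnes n} t := by
  refine ⟨fun h i hi hX => ?_, fun h => ?_⟩
  · exact (h.trans_le (iInf₂_le i hX)).not_ge (by exact_mod_cast hi)
  · refine (ENat.add_one_le_iff (ENat.natCast_ne_top t)).1 (le_iInf₂ fun i hX => ?_)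
    have hti : t < i := not_le.1 fun hi => h i hi hX
    exact_mod_cast hti

theorem tsum_indicator_lt_eq (N : ℕ∞) :
    ∑' t : ℕ, {t : ℕ | (t : ℕ∞) < N}.indicator (1 : ℕ → ENNReal) t = N := by
  have hcard : {t : ℕ | (t : ℕ∞) < N}.encard = N := by
    induction N using ENat.recTopCoe with
    | top => simp
    | coe m =>
      have hrange : {t : ℕ | (t : ℕ∞) < m} = Finset.range m := by ext; simp
      rw [hrange, Set.encard_coe_eq_coe_finsetCard, Finset.card_range]
  rw [← tsum_subtype {t : ℕ | (t : ℕ∞) < N} (1 : ℕ → ENNReal)]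
  simpa only [hcard, Pi.one_apply] using ENNReal.tsum_set_one {t : ℕ | (t : ℕ∞) < N}

variable {X}

theorem expectedRuntime_eq_tsum [MeasurableSpace Ω] (μ : Measure Ω) (hX : ∀ t, Measurable (X t)) :
    expectedRuntime μ X = ∑' t, μ (avoidSet X {allOnes n} t) := by
  have hA := measurableSet_avoidSet hX (measurableSet_singleton (allOnes n))
  have htail : ∀ ω, (runtime X ω : ENNReal) =
      ∑' t, (avoidSet X {allOnes n} t).indicator 1 ω := fun ω => by
    rw [← tsum_indicator_lt_eq]
    refine tsum_congr fun t => ?_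
    simp only [lt_runtime_iff]
    rfl
  simp only [expectedRuntime, htail]
  rw [lintegral_tsum fun t => (measurable_one.indicator (hA t)).aemeasurable]
  exact tsum_congr fun t => lintegral_indicator_one (hA t)

end Runtime

section Transition

/-- The probability with which the MMAHH leaves its current acceptance operator. -/
def switchRate (p q : ℝ) : AcceptOp → ℝ
  | .OI => p
  | .OW => q

/-- The acceptance operator to which the MMAHH switches from a given one. -/
def AcceptOp.other : AcceptOp → AcceptOp
  | .OI => .OW
  | .OW => .OI

theorem AcceptOp.ne_iff_eq_other {s r : AcceptOp} : s ≠ r ↔ s = r.other := by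
  cases s <;> cases r <;> simp [AcceptOp.other]

instance : MeasurableSingletonClass AcceptOp := ⟨fun _ => trivial⟩

/-- The transition matrix of the pairs `(x_t, s_t)` of the MMAHH on `f`. -/
noncomputable def mmahhTransition {n : ℕ} (p q : ℝ) (f : BitString n → ℝ)
    (a b : BitString n × AcceptOp) : ℝ :=
  moveProb f a.2 a.1 b.1 * switchProb p q a.2 b.2

theorem IsMMAHHRun.isMarkovChain {n : ℕ} {p q : ℝ} {f : BitString n → ℝ} {Ω : Type*}
    [MeasurableSpace Ω] {μ : Measure Ω} {X : ℕ → Ω → BitString n} {S : ℕ → Ω → AcceptOp}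
    (hrun : IsMMAHHRun p q f μ X S) :
    IsMarkovChain (mmahhTransition p q f) μ fun t ω => (X t ω, S t ω) where
  measurable t := (hrun.measurable_X t).prodMk (hrun.measurable_S t)
  step t z := by
    simpa only [Prod.ext_iff, mmahhTransition] using
      hrun.step t (fun i => (z i).1) (fun i => (z i).2)

variable {n : ℕ} (p q : ℝ) (f : BitString n → ℝ) (x : BitString n) (s : AcceptOp)

theorem sum_switchProb_mul (F : AcceptOp → ℝ) :
    ∑ r, switchProb p q s r * F r =
      (1 - switchRate p q s) * F s + switchRate p q s * F s.other := by
  have huniv : (Finset.univ : Finset AcceptOp) = {.OI, .OW} := rfl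
  cases s <;> simp [huniv, switchProb, switchRate, AcceptOp.other, add_comm]

theorem sum_moveProb_mul (F : BitString n → ℝ) :
    ∑ y, moveProb f s x y * F y = (∑ v, F (nextSolution f s x v)) / n := by
  classical
  have hfiber : ∀ y, moveProb f s x y * F y =
      (∑ v with nextSolution f s x v = y, F (nextSolution f s x v)) / n := fun y => by
    rw [Finset.sum_congr rfl fun v hv => congrArg F (Finset.mem_filter.1 hv).2, Finset.sum_const,
      nsmul_eq_mul, moveProb, div_mul_eq_mul_div]
  simp only [hfiber, ← Finset.sum_div]
  rw [Finset.sum_fiberwise]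

theorem sum_mmahhTransition_mul (F : BitString n → AcceptOp → ℝ) :
    ∑ b, mmahhTransition p q f (x, s) b * F b.1 b.2 =
      ((1 - switchRate p q s) * ∑ v, F (nextSolution f s x v) s +
        switchRate p q s * ∑ v, F (nextSolution f s x v) s.other) / n := by
  simp only [mmahhTransition, Fintype.sum_prod_type, mul_assoc, ← Finset.mul_sum,
    sum_switchProb_mul, sum_moveProb_mul, Finset.sum_add_distrib]

variable {p q f x s} in
theorem le_sum_mmahhTransition_mul {F : BitString n → AcceptOp → ℝ} (hs : 0 ≤ switchRate p q s)
    (hF : ∀ y, 0 ≤ F y s.other) :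
    (1 - switchRate p q s) * (∑ v, F (nextSolution f s x v) s) / n ≤
      ∑ b, mmahhTransition p q f (x, s) b * F b.1 b.2 := by
  rw [sum_mmahhTransition_mul]
  gcongr
  exact le_add_of_nonneg_right (mul_nonneg hs (Finset.sum_nonneg fun v _ => hF _))

theorem sum_mmahhTransition (hn : n ≠ 0) : ∑ b, mmahhTransition p q f (x, s) b = 1 := by
  have h := sum_mmahhTransition_mul p q f x s fun _ _ => 1
  simpa [← add_mul, hn] using h

end Transition

section Layers

variable {n : ℕ} {x : BitString n} {v : Fin n}

/-- The Hamming distance to the optimum, so that `layer n h` is the fibre over `h`. -/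
def distOpt (x : BitString n) : ℕ := hammingDist x (allOnes n)

theorem distOpt_eq_card (x : BitString n) :
    distOpt x = ({v | x v = false} : Finset (Fin n)).card := by
  simp [distOpt, hammingDist, allOnes]

theorem distOpt_le (x : BitString n) : distOpt x ≤ n := by
  simpa [distOpt] using hammingDist_le_card_fintype (x := x) (y := allOnes n)

theorem distOpt_flipBit_add_one (hv : x v = false) : distOpt (flipBit x v) + 1 = distOpt x := by
  have hinsert : (Finset.univ.filter fun u => x u = false) =
      insert v (Finset.univ.filter fun u => flipBit x v u = false) := by
    ext u
    rcases eq_or_ne u v with rfl | hu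
    · simp [hv]
    · have hother : flipBit x v u = x u := Function.update_of_ne hu _ _
      simp [hu, hother]
  rw [distOpt_eq_card, distOpt_eq_card, hinsert,
    Finset.card_insert_of_notMem (by simp [flipBit, hv])]

theorem flipBit_flipBit (x : BitString n) (v : Fin n) : flipBit (flipBit x v) v = x := by
  simp [flipBit]

theorem distOpt_flipBit_of_true (hv : x v = true) : distOpt (flipBit x v) = distOpt x + 1 := by
  have h := distOpt_flipBit_add_one (x := flipBit x v) (v := v) (by simp [flipBit, hv])
  rw [← h, flipBit_flipBit]

theorem sum_ite_eq_false (x : BitString n) (a b : ℝ) :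
    ∑ v, (if x v = false then a else b) = distOpt x * a + (n - distOpt x) * b := by
  have hcard : (distOpt x : ℝ) + ({v | ¬x v = false} : Finset (Fin n)).card = n := by
    rw [distOpt_eq_card, ← Nat.cast_add, Finset.card_filter_add_card_filter_not, Finset.card_univ,
      Fintype.card_fin]
  rw [Finset.sum_ite, Finset.sum_const, Finset.sum_const, nsmul_eq_mul, nsmul_eq_mul,
    ← distOpt_eq_card, ← hcard, add_sub_cancel_left]

/-- `g h` is the acceptance operator that accepts the moves from layer `h + 1` to layer `h`. Such a
`g` exists if and only if `f` is strictly monotone between any two neighbouring layers. -/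
def IsGuidedBy (f : BitString n → ℝ) (g : ℕ → AcceptOp) : Prop :=
  ∀ h, ∀ x ∈ layer n h, ∀ y ∈ layer n (h + 1), (g h).Accepts (f y) (f x)

theorem AcceptOp.accepts_iff_eq {r s : AcceptOp} {a b : ℝ} (h : r.Accepts a b) :
    s.Accepts a b ↔ s = r := by
  cases r <;> cases s <;> simp_all [AcceptOp.Accepts, le_of_lt]

theorem AcceptOp.accepts_swap_iff_ne {r s : AcceptOp} {a b : ℝ} (h : r.Accepts a b) :
    s.Accepts b a ↔ s ≠ r := by
  cases r <;> cases s <;> simp_all [AcceptOp.Accepts, le_of_lt]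

namespace IsGuidedBy

variable {f : BitString n → ℝ} {g : ℕ → AcceptOp} {h : ℕ}

theorem nextSolution_of_false (hfg : IsGuidedBy f g) (hx : distOpt x = h + 1) (hv : x v = false)
    (s : AcceptOp) : nextSolution f s x v = if s = g h then flipBit x v else x := by
  have hflip : distOpt (flipBit x v) = h := by have := distOpt_flipBit_add_one hv; omega
  simp only [nextSolution, AcceptOp.accepts_iff_eq (hfg h _ hflip _ hx)]

theorem nextSolution_of_true (hfg : IsGuidedBy f g) (hv : x v = true) (s : AcceptOp) :
    nextSolution f s x v = if s = g (distOpt x) then x else flipBit x v := by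
  have hworse := hfg (distOpt x) x rfl (flipBit x v) (distOpt_flipBit_of_true hv)
  simp only [nextSolution, AcceptOp.accepts_swap_iff_ne hworse, ite_not]

end IsGuidedBy

end Layers

section Potential

/-- The distances `0 < h < n` at which the operator that accepts the moves towards the optimum
changes, if `g h` is the one that accepts them from layer `h + 1` to layer `h`. -/
def turningDists (n : ℕ) (g : ℕ → AcceptOp) : Finset ℕ := {h ∈ Finset.Ioo 0 n | g (h - 1) ≠ g h}

/-- An estimate for the chance of getting from distance `h` to the optimum before moving away again:
each turning distance `j ≤ h` costs a factor `j / (4 n)`, and each distance `1 ≤ j ≤ h`, turning or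
not, a factor `1 / (1 + lam / j)` for the switches. -/
noncomputable def reachWeight (n : ℕ) (g : ℕ → AcceptOp) (lam : ℝ) (h : ℕ) : ℝ :=
  (∏ j ∈ Finset.Icc 1 h, (1 + lam / j) *
    (if j ∈ turningDists n g then 4 * n / j else 1 : ℝ))⁻¹

/-- The potential of the state of the MMAHH at distance `h` with operator `s`, which increases in
expectation. With a wrong operator it vanishes except at the turning distances, since there such an
operator at least keeps the solution from moving away. -/
noncomputable def potential (n : ℕ) (g : ℕ → AcceptOp) (lam : ℝ) : ℕ → AcceptOp → ℝ
  | 0, _ => 1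
  | h + 1, s => ((if s = g h then 1 else 0) + if h + 1 ∈ turningDists n g then 1 else 0) *
      reachWeight n g lam (h + 1)

variable {n : ℕ} {g : ℕ → AcceptOp} {lam : ℝ} {h : ℕ}

theorem add_one_mem_turningDists_iff : h + 1 ∈ turningDists n g ↔ h + 1 < n ∧ g h ≠ g (h + 1) := by
  simp [turningDists]

theorem reachWeight_zero : reachWeight n g lam 0 = 1 := by
  simp [reachWeight]

theorem reachWeight_succ : reachWeight n g lam (h + 1) = reachWeight n g lam h *
    ((1 + lam / (h + 1 : ℕ)) *
      (if h + 1 ∈ turningDists n g then 4 * n / (h + 1 : ℕ) else 1 : ℝ))⁻¹ := by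
  rw [reachWeight, Finset.prod_Icc_succ_top (Nat.le_add_left 1 h), mul_inv, reachWeight]

theorem pos_of_mem_turningDists {j : ℕ} (hj : j ∈ turningDists n g) : 0 < j :=
  (Finset.mem_Ioo.1 (Finset.mem_filter.1 hj).1).1

theorem lt_of_mem_turningDists {j : ℕ} (hj : j ∈ turningDists n g) : j < n :=
  (Finset.mem_Ioo.1 (Finset.mem_filter.1 hj).1).2

theorem reachWeight_of_notMem (hlam : 0 ≤ lam) (hh : h + 1 ∉ turningDists n g) :
    (h + 1) * reachWeight n g lam h = (h + 1 + lam) * reachWeight n g lam (h + 1) := by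
  rw [reachWeight_succ, if_neg hh]
  push_cast
  field_simp

theorem reachWeight_of_mem (hlam : 0 ≤ lam) (hh : h + 1 ∈ turningDists n g) :
    (h + 1) * reachWeight n g lam h =
      4 * n * (1 + lam / (h + 1)) * reachWeight n g lam (h + 1) := by
  have hn : (n : ℝ) ≠ 0 := by exact_mod_cast (Nat.zero_lt_of_lt (lt_of_mem_turningDists hh)).ne'
  rw [reachWeight_succ, if_pos hh]
  push_cast
  field_simp

theorem reachWeight_pos (hlam : 0 ≤ lam) (h : ℕ) : 0 < reachWeight n g lam h := by
  refine inv_pos.2 (Finset.prod_pos fun j _ => mul_pos (by positivity) ?_)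
  split_ifs with hjD
  · have hj : (0 : ℝ) < j := by exact_mod_cast pos_of_mem_turningDists hjD
    have hn : (j : ℝ) < n := by exact_mod_cast lt_of_mem_turningDists hjD
    have := hj.trans hn
    positivity
  · exact one_pos

theorem reachWeight_antitone (hlam : 0 ≤ lam) : Antitone (reachWeight n g lam) := by
  refine antitone_nat_of_succ_le fun h => ?_
  rw [reachWeight_succ]
  refine mul_le_of_le_one_right (reachWeight_pos hlam h).le (inv_le_one_of_one_le₀ ?_)
  refine one_le_mul_of_one_le_of_one_le (le_add_of_nonneg_right (by positivity)) ?_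
  split_ifs with hh
  · have hhn : ((h + 1 : ℕ) : ℝ) < n := by exact_mod_cast lt_of_mem_turningDists hh
    rw [one_le_div (by positivity)]
    linarith [(n.cast_nonneg : (0 : ℝ) ≤ n)]
  · exact le_rfl

theorem four_mul_reachWeight_le (hlam : 0 ≤ lam) (hh : h + 1 ∈ turningDists n g) :
    4 * n * reachWeight n g lam (h + 1) ≤ (h + 1) * reachWeight n g lam h := by
  have hA := reachWeight_pos (n := n) (g := g) hlam (h + 1)
  rw [reachWeight_of_mem hlam hh]
  refine mul_le_mul_of_nonneg_right (le_mul_of_one_le_right (by positivity) ?_) hA.le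
  exact le_add_of_nonneg_right (by positivity)

theorem prod_one_add_div_le_exp (hlam : 0 ≤ lam) (n : ℕ) :
    ∏ j ∈ Finset.Icc 1 n, (1 + lam / j) ≤ Real.exp (lam * (1 + Real.log n)) := by
  have hharmonic : ∑ j ∈ Finset.Icc 1 n, (j : ℝ)⁻¹ ≤ 1 + Real.log n := by
    simpa only [harmonic_eq_sum_Icc, Rat.cast_sum, Rat.cast_inv, Rat.cast_natCast] using
      harmonic_le_one_add_log n
  calc ∏ j ∈ Finset.Icc 1 n, (1 + lam / j)
      ≤ Real.exp (∑ j ∈ Finset.Icc 1 n, lam / j) :=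
        Real.prod_one_add_le_exp_sum _ fun j => by positivity
    _ ≤ Real.exp (lam * (1 + Real.log n)) := by
        simp only [div_eq_mul_inv, ← Finset.mul_sum]
        exact Real.exp_le_exp.2 (mul_le_mul_of_nonneg_left hharmonic hlam)

theorem inv_reachWeight_le (hlam : 0 ≤ lam) :
    (reachWeight n g lam n)⁻¹ ≤ Real.exp (lam * (1 + Real.log n)) *
      ((4 * n) ^ (turningDists n g).card / ∏ j ∈ turningDists n g, (j : ℝ)) := by
  have hsub : Finset.Icc 1 n ∩ turningDists n g = turningDists n g :=
    Finset.inter_eq_right.2 fun j hj =>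
      Finset.mem_Icc.2 ⟨pos_of_mem_turningDists hj, (lt_of_mem_turningDists hj).le⟩
  rw [reachWeight, inv_inv, Finset.prod_mul_distrib, Finset.prod_ite_mem, hsub,
    Finset.prod_div_distrib, Finset.prod_const]
  exact mul_le_mul_of_nonneg_right (prod_one_add_div_le_exp hlam n) (by positivity)

theorem potential_nonneg (hlam : 0 ≤ lam) : ∀ h s, 0 ≤ potential n g lam h s
  | 0, _ => zero_le_one
  | h + 1, s => mul_nonneg (by positivity) (reachWeight_pos hlam (h + 1)).le

theorem reachWeight_le_potential (hlam : 0 ≤ lam) (h : ℕ) :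
    reachWeight n g lam (h + 1) ≤ potential n g lam (h + 1) (g h) := by
  rw [potential, if_pos rfl]
  exact le_mul_of_one_le_left (reachWeight_pos hlam _).le (le_add_of_nonneg_right (by positivity))

theorem potential_of_lt (hh : h < n) : potential n g lam h (g h) = reachWeight n g lam h := by
  cases h with
  | zero => exact reachWeight_zero.symm
  | succ h =>
    by_cases hg : g (h + 1) = g h <;>
      simp [potential, add_one_mem_turningDists_iff, hh, hg, Ne.symm]

theorem potential_le_one (hlam : 0 ≤ lam) : ∀ h s, potential n g lam h s ≤ 1
  | 0, _ => le_rfl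
  | h + 1, s => by
    have hA := reachWeight_pos (n := n) (g := g) hlam (h + 1)
    have hle_one : ∀ i, reachWeight n g lam i ≤ 1 := fun i =>
      (reachWeight_antitone hlam i.zero_le).trans_eq reachWeight_zero
    have hop : (if s = g h then (1 : ℝ) else 0) ≤ 1 := by split_ifs <;> norm_num
    by_cases hh : h + 1 ∈ turningDists n g
    · have hhn : (h + 1 : ℝ) ≤ n := by exact_mod_cast (lt_of_mem_turningDists hh).le
      have htwo : 2 * reachWeight n g lam (h + 1) ≤ 1 := by
        nlinarith [four_mul_reachWeight_le hlam hh, hle_one h]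
      rw [potential, if_pos hh]
      nlinarith
    · rw [potential, if_neg hh, add_zero]
      nlinarith [hle_one (h + 1)]

end Potential

section Drift

variable {n : ℕ} {f : BitString n → ℝ} {g : ℕ → AcceptOp} {lam : ℝ} {x : BitString n} {h : ℕ}
  {s : AcceptOp}

namespace IsGuidedBy

theorem sum_comp_distOpt_nextSolution (hfg : IsGuidedBy f g) (hx : distOpt x = h + 1)
    (s : AcceptOp) (F : ℕ → ℝ) :
    ∑ v, F (distOpt (nextSolution f s x v)) = (h + 1) * F (if s = g h then h else h + 1) +
      (n - (h + 1)) * F (if s = g (h + 1) then h + 1 else h + 2) := by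
  have hnext : ∀ v, F (distOpt (nextSolution f s x v)) =
      if x v = false then F (if s = g h then h else h + 1)
      else F (if s = g (h + 1) then h + 1 else h + 2) := fun v => by
    cases hv : x v
    · have hflip := distOpt_flipBit_add_one hv
      rw [hfg.nextSolution_of_false hx hv, if_pos rfl, apply_ite distOpt, hx]
      congr
      omega
    · have hflip := distOpt_flipBit_of_true hv
      rw [hfg.nextSolution_of_true hv, if_neg Bool.false_ne_true.symm, apply_ite distOpt, hflip, hx]
  simp only [hnext, sum_ite_eq_false, hx]
  push_cast
  rfl

theorem sum_comp_distOpt_nextSolution_of_notMem (hfg : IsGuidedBy f g) (hx : distOpt x = h + 1)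
    (hh : h + 1 ∉ turningDists n g) (s : AcceptOp) (F : ℕ → ℝ) :
    ∑ v, F (distOpt (nextSolution f s x v)) = (h + 1) * F (if s = g h then h else h + 1) +
      (n - (h + 1)) * F (if s = g h then h + 1 else h + 2) := by
  rw [hfg.sum_comp_distOpt_nextSolution hx]
  rcases (hx ▸ distOpt_le x : h + 1 ≤ n).eq_or_lt with rfl | hhn
  · simp
  · rw [add_one_mem_turningDists_iff, not_and_not_right] at hh
    rw [hh hhn]

theorem sum_potential_of_eq_of_mem (hfg : IsGuidedBy f g) (hlam : 0 ≤ lam) (hx : distOpt x = h + 1)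
    (hh : h + 1 ∈ turningDists n g) :
    4 * n * reachWeight n g lam (h + 1) ≤
      ∑ v, potential n g lam (distOpt (nextSolution f (g h) x v)) (g h) := by
  have hhn : (h + 1 : ℝ) ≤ n := by exact_mod_cast (lt_of_mem_turningDists hh).le
  rw [hfg.sum_comp_distOpt_nextSolution hx (g h) (potential n g lam · (g h)), if_pos rfl,
    potential_of_lt ((Nat.lt_succ_self h).trans (lt_of_mem_turningDists hh))]
  exact (four_mul_reachWeight_le hlam hh).trans
    (le_add_of_nonneg_right (mul_nonneg (sub_nonneg.2 hhn) (potential_nonneg hlam _ _)))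

theorem sum_potential_of_eq_of_notMem (hfg : IsGuidedBy f g) (hlam : 0 ≤ lam)
    (hx : distOpt x = h + 1) (hh : h + 1 ∉ turningDists n g) :
    ∑ v, potential n g lam (distOpt (nextSolution f (g h) x v)) (g h) =
      (n + lam) * reachWeight n g lam (h + 1) := by
  have hhn : h + 1 ≤ n := hx ▸ distOpt_le x
  have hpot : potential n g lam (h + 1) (g h) = reachWeight n g lam (h + 1) := by
    simp [potential, hh]
  rw [hfg.sum_comp_distOpt_nextSolution_of_notMem hx hh (g h) (potential n g lam · (g h)),
    if_pos rfl, if_pos rfl, potential_of_lt hhn, hpot, reachWeight_of_notMem hlam hh]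
  ring

theorem sum_potential_of_ne_of_mem (hfg : IsGuidedBy f g) (hx : distOpt x = h + 1)
    (hh : h + 1 ∈ turningDists n g) (hs : s ≠ g h) (r : AcceptOp) :
    ∑ v, potential n g lam (distOpt (nextSolution f s x v)) r =
      n * potential n g lam (h + 1) r := by
  have hs_succ : s = g (h + 1) := by
    have hturn := (add_one_mem_turningDists_iff.1 hh).2
    rw [AcceptOp.ne_iff_eq_other.1 hs, AcceptOp.ne_iff_eq_other.1 hturn.symm]
  rw [hfg.sum_comp_distOpt_nextSolution hx s (potential n g lam · r), if_neg hs, if_pos hs_succ]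
  ring

theorem sum_potential_of_ne_of_notMem (hfg : IsGuidedBy f g) (hlam : 0 ≤ lam)
    (hx : distOpt x = h + 1) (hh : h + 1 ∉ turningDists n g) (hs : s ≠ g h) :
    n * reachWeight n g lam n ≤ ∑ v, potential n g lam (distOpt (nextSolution f s x v)) (g h) := by
  have hhn : h + 1 ≤ n := hx ▸ distOpt_le x
  have hanti := reachWeight_antitone (n := n) (g := g) hlam
  have hstay : reachWeight n g lam n ≤ potential n g lam (h + 1) (g h) :=
    (hanti hhn).trans (reachWeight_le_potential hlam h)
  have haway : (n - (h + 1)) * reachWeight n g lam n ≤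
      (n - (h + 1)) * potential n g lam (h + 2) (g h) := by
    rcases hhn.eq_or_lt with rfl | hlt
    · simp
    · rw [add_one_mem_turningDists_iff, not_and_not_right] at hh
      rw [hh hlt]
      refine mul_le_mul_of_nonneg_left ((hanti hlt).trans (reachWeight_le_potential hlam _)) ?_
      exact sub_nonneg.2 (by exact_mod_cast hhn)
  rw [hfg.sum_comp_distOpt_nextSolution_of_notMem hx hh s (potential n g lam · (g h)),
    if_neg hs, if_neg hs]
  calc n * reachWeight n g lam n
      = (h + 1) * reachWeight n g lam n + (n - (h + 1)) * reachWeight n g lam n := by ring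
    _ ≤ _ := add_le_add (mul_le_mul_of_nonneg_left hstay (by positivity)) haway

theorem potential_drift_of_eq_of_mem (hfg : IsGuidedBy f g) {p q ρ : ℝ} (hlam : 0 ≤ lam)
    (hρ : 0 ≤ ρ) (hrate : switchRate p q (g h) ∈ Set.Icc ρ (1 / 4)) (hx : distOpt x = h + 1)
    (hh : h + 1 ∈ turningDists n g) :
    potential n g lam (h + 1) (g h) + ρ * reachWeight n g lam n ≤
      ∑ b, mmahhTransition p q f (x, g h) b * potential n g lam (distOpt b.1) b.2 := by
  set A := reachWeight n g lam (h + 1)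
  set e := switchRate p q (g h)
  obtain ⟨hρe, he⟩ := hrate
  have hhn : h + 1 ≤ n := hx ▸ distOpt_le x
  have hn : (0 : ℝ) < n := by exact_mod_cast Nat.zero_lt_of_lt hhn
  have hA : 0 < A := reachWeight_pos hlam _
  have hgain : ρ * reachWeight n g lam n ≤ ρ * A :=
    mul_le_mul_of_nonneg_left (reachWeight_antitone hlam hhn) hρ
  have hpot : potential n g lam (h + 1) (g h) = 2 * A := by
    rw [potential, if_pos rfl, if_pos hh, one_add_one_eq_two]
  refine le_trans ?_ (le_sum_mmahhTransition_mul (F := fun y r => potential n g lam (distOpt y) r)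
    (hρ.trans hρe) fun y => potential_nonneg hlam _ _)
  rw [hpot, le_div_iff₀ hn]
  calc (2 * A + ρ * reachWeight n g lam n) * n
      ≤ (2 * A + ρ * A) * n := by gcongr
    _ ≤ (1 - e) * (4 * n * A) := by nlinarith [mul_pos hA hn]
    _ ≤ _ := mul_le_mul_of_nonneg_left (hfg.sum_potential_of_eq_of_mem hlam hx hh) (by linarith)

/-- The value `lam = 3 n σ` comes from `(1 - σ) (1 + 3 σ) ≥ 1 + σ` for `σ ≤ 1 / 4`. -/
theorem potential_drift_of_eq_of_notMem (hfg : IsGuidedBy f g) {p q ρ σ : ℝ} (hρ : 0 ≤ ρ)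
    (hrate : switchRate p q (g h) ∈ Set.Icc ρ σ) (hσ : σ ≤ 1 / 4) (hx : distOpt x = h + 1)
    (hh : h + 1 ∉ turningDists n g) :
    potential n g (3 * n * σ) (h + 1) (g h) + ρ * reachWeight n g (3 * n * σ) n ≤
      ∑ b, mmahhTransition p q f (x, g h) b * potential n g (3 * n * σ) (distOpt b.1) b.2 := by
  set lam := 3 * n * σ with hlam_def
  set A := reachWeight n g lam (h + 1)
  set e := switchRate p q (g h)
  obtain ⟨hρe, heσ⟩ := hrate
  have hhn : h + 1 ≤ n := hx ▸ distOpt_le x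
  have hn : (0 : ℝ) < n := by exact_mod_cast Nat.zero_lt_of_lt hhn
  have hlam : 0 ≤ lam := by have := hρ.trans (hρe.trans heσ); positivity
  have hA : 0 < A := reachWeight_pos hlam _
  have hgain : ρ * reachWeight n g lam n ≤ ρ * A :=
    mul_le_mul_of_nonneg_left (reachWeight_antitone hlam hhn) hρ
  have hpot : potential n g lam (h + 1) (g h) = A := by
    rw [potential, if_pos rfl, if_neg hh, add_zero, one_mul]
  refine le_trans ?_ (le_sum_mmahhTransition_mul (F := fun y r => potential n g lam (distOpt y) r)
    (hρ.trans hρe) fun y => potential_nonneg hlam _ _)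
  rw [hpot, hfg.sum_potential_of_eq_of_notMem hlam hx hh, le_div_iff₀ hn]
  calc (A + ρ * reachWeight n g lam n) * n
      ≤ (1 + ρ) * (n * A) := by nlinarith
    _ ≤ ((1 - e) * (1 + 3 * σ)) * (n * A) := by
      refine mul_le_mul_of_nonneg_right ?_ (by positivity)
      nlinarith [hρ.trans hρe]
    _ = (1 - e) * ((n + lam) * A) := by rw [hlam_def]; ring

theorem potential_drift_of_ne (hfg : IsGuidedBy f g) {p q ρ : ℝ}
    (hlam : 0 ≤ lam) (hρ : 0 ≤ ρ) (hrate : switchRate p q s ∈ Set.Icc ρ 1)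
    (hx : distOpt x = h + 1) (hs : s ≠ g h) :
    potential n g lam (h + 1) s + ρ * reachWeight n g lam n ≤
      ∑ b, mmahhTransition p q f (x, s) b * potential n g lam (distOpt b.1) b.2 := by
  set e := switchRate p q s
  have hhn : h + 1 ≤ n := hx ▸ distOpt_le x
  have hn : (0 : ℝ) < n := by exact_mod_cast Nat.zero_lt_of_lt hhn
  have hgain : ρ * reachWeight n g lam n ≤ e * reachWeight n g lam n :=
    mul_le_mul_of_nonneg_right hrate.1 (reachWeight_pos hlam n).le
  rw [sum_mmahhTransition_mul p q f x s fun y r => potential n g lam (distOpt y) r,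
    ← AcceptOp.ne_iff_eq_other.1 hs.symm, le_div_iff₀ hn]
  by_cases hh : h + 1 ∈ turningDists n g
  · have hpot : potential n g lam (h + 1) s + reachWeight n g lam (h + 1) =
        potential n g lam (h + 1) (g h) := by
      simp only [potential, if_neg hs, if_pos hh, if_pos]
      ring
    have hA : e * reachWeight n g lam n ≤ e * reachWeight n g lam (h + 1) :=
      mul_le_mul_of_nonneg_left (reachWeight_antitone hlam hhn) (hρ.trans hrate.1)
    rw [hfg.sum_potential_of_ne_of_mem hx hh hs, hfg.sum_potential_of_ne_of_mem hx hh hs, ← hpot]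
    nlinarith
  · have hpot : potential n g lam (h + 1) s = 0 := by
      rw [potential, if_neg hs, if_neg hh, add_zero, zero_mul]
    have hsame : 0 ≤ ∑ v, potential n g lam (distOpt (nextSolution f s x v)) s :=
      Finset.sum_nonneg fun v _ => potential_nonneg hlam _ _
    rw [hpot, zero_add]
    calc ρ * reachWeight n g lam n * n
        ≤ e * (n * reachWeight n g lam n) := by nlinarith
      _ ≤ e * ∑ v, potential n g lam (distOpt (nextSolution f s x v)) (g h) :=
        mul_le_mul_of_nonneg_left (hfg.sum_potential_of_ne_of_notMem hlam hx hh hs)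
          (hρ.trans hrate.1)
      _ ≤ _ := le_add_of_nonneg_left (mul_nonneg (sub_nonneg.2 hrate.2) hsame)

theorem potential_drift (hfg : IsGuidedBy f g) {p q ρ σ : ℝ} (hρ : 0 ≤ ρ)
    (hrate : ∀ s, switchRate p q s ∈ Set.Icc ρ σ) (hσ : σ ≤ 1 / 4) (hx : x ≠ allOnes n)
    (s : AcceptOp) :
    potential n g (3 * n * σ) (distOpt x) s + ρ * reachWeight n g (3 * n * σ) n ≤
      ∑ b, mmahhTransition p q f (x, s) b * potential n g (3 * n * σ) (distOpt b.1) b.2 := by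
  have hσ0 : 0 ≤ σ := hρ.trans ((hrate s).1.trans (hrate s).2)
  have hlam : 0 ≤ 3 * n * σ := by positivity
  obtain ⟨h, hxh⟩ := Nat.exists_eq_succ_of_ne_zero (hammingDist_ne_zero.2 hx)
  change distOpt x = h + 1 at hxh
  rw [hxh]
  by_cases hs : s = g h
  · subst hs
    by_cases hh : h + 1 ∈ turningDists n g
    · exact hfg.potential_drift_of_eq_of_mem hlam hρ (Set.Icc_subset_Icc_right hσ (hrate _)) hxh hh
    · exact hfg.potential_drift_of_eq_of_notMem hρ (hrate _) hσ hxh hh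
  · have hσ1 : σ ≤ 1 := by linarith
    exact hfg.potential_drift_of_ne hlam hρ (Set.Icc_subset_Icc_right hσ1 (hrate _)) hxh hs

theorem expectedRuntime_le (hfg : IsGuidedBy f g) {p q ρ σ : ℝ} (hρ : 0 < ρ)
    (hrate : ∀ s, switchRate p q s ∈ Set.Icc ρ σ) (hσ : σ ≤ 1 / 4) (hn : n ≠ 0) {Ω : Type*}
    [MeasurableSpace Ω] {μ : Measure Ω} [IsProbabilityMeasure μ] {X : ℕ → Ω → BitString n}
    {S : ℕ → Ω → AcceptOp}
    (hZ : IsMarkovChain (mmahhTransition p q f) μ fun t ω => (X t ω, S t ω)) :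
    expectedRuntime μ X ≤ ENNReal.ofReal (1 / (ρ * reachWeight n g (3 * n * σ) n)) := by
  set lam := 3 * n * σ
  set V : BitString n × AcceptOp → ℝ := fun z => 1 - potential n g lam (distOpt z.1) z.2
  have hlam : 0 ≤ lam := by
    have := hρ.le.trans ((hrate .OI).1.trans (hrate .OI).2)
    positivity
  have hδ : 0 < ρ * reachWeight n g lam n := mul_pos hρ (reachWeight_pos hlam n)
  have hV : ∀ z, 0 ≤ V z := fun z => sub_nonneg.2 (potential_le_one hlam _ _)
  have hdrift : ∀ z ∉ {z : BitString n × AcceptOp | z.1 ∈ ({allOnes n} : Set (BitString n))},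
      ∑ b, mmahhTransition p q f z b * V b ≤ V z - ρ * reachWeight n g lam n := by
    rintro ⟨x, s⟩ hx
    simp only [V, mul_sub, mul_one, Finset.sum_sub_distrib, sum_mmahhTransition p q f x s hn]
    linarith [hfg.potential_drift hρ.le hrate hσ hx s]
  have hinit : ∫ ω, V (X 0 ω, S 0 ω) ∂μ ≤ 1 := by
    have hVle : ∀ z, V z ≤ 1 := fun z => sub_le_self 1 (potential_nonneg hlam _ _)
    simpa using integral_mono (hZ.integrable_comp V 0) (integrable_const 1)
      fun ω => hVle (X 0 ω, S 0 ω)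
  have hX : ∀ t, Measurable (X t) := fun t => measurable_fst.comp (hZ.measurable t)
  rw [expectedRuntime_eq_tsum μ hX]
  exact (hZ.tsum_measure_avoidSet_le hV hδ hdrift).trans
    (ENNReal.ofReal_le_ofReal (div_le_div_of_nonneg_right hinit hδ.le))

end IsGuidedBy

end Drift

section SeqOpt

/-- The operators that accept the moves towards the optimum if the turning distances are the
elements of `D`: OI next to the optimum, and the other operator from each element of `D` on. -/
def alternatingOp (D : Finset ℕ) (h : ℕ) : AcceptOp :=
  if Even ({j ∈ D | j ≤ h} : Finset ℕ).card then .OI else .OW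

theorem alternatingOp_eq_add_one_iff {D : Finset ℕ} {h : ℕ} :
    alternatingOp D h = alternatingOp D (h + 1) ↔ h + 1 ∉ D := by
  by_cases hh : h + 1 ∈ D
  · have hinsert : (D.filter (· ≤ h + 1)) = insert (h + 1) (D.filter (· ≤ h)) := by
      ext j
      grind
    have hcard : (D.filter (· ≤ h + 1)).card = (D.filter (· ≤ h)).card + 1 := by
      rw [hinsert, Finset.card_insert_of_notMem (by simp)]
    by_cases heven : Even (D.filter (· ≤ h)).card <;>
      simp [alternatingOp, hcard, Nat.even_add_one, heven, hh]
  · have hsame : D.filter (· ≤ h + 1) = D.filter (· ≤ h) := by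
      ext j
      grind
    simp [alternatingOp, hsame, hh]

theorem turningDists_alternatingOp {n : ℕ} {D : Finset ℕ} (hD : D ⊆ Finset.Ioo 0 n) :
    turningDists n (alternatingOp D) = D := by
  ext j
  cases j with
  | zero =>
    have hzero : 0 ∉ D := fun h0 => (Finset.mem_Ioo.1 (hD h0)).1.false
    simp [turningDists, hzero]
  | succ h =>
    rw [add_one_mem_turningDists_iff, ne_eq, alternatingOp_eq_add_one_iff, not_not]
    exact and_iff_right_of_imp fun hh => (Finset.mem_Ioo.1 (hD hh)).2

namespace SeqOpt

variable {n k : ℕ} {d : ℕ → ℕ} {f : BitString n → ℝ}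

theorem strictAntiOn (hf : SeqOpt n k d f) : StrictAntiOn d (Set.Iic (k + 1)) :=
  strictAntiOn_Iic_of_succ_lt fun l hl => hf.d_lt l (Nat.le_of_lt_succ hl)

theorem injOn (hf : SeqOpt n k d f) : Set.InjOn d (Finset.Icc 1 k) :=
  hf.strictAntiOn.injOn.mono fun _ hl =>
    Set.mem_Iic.2 ((Finset.mem_Icc.1 (Finset.mem_coe.1 hl)).2.trans k.le_succ)

theorem image_subset_Ioo (hf : SeqOpt n k d f) :
    (Finset.Icc 1 k).image d ⊆ Finset.Ioo 0 n := by
  simp only [Finset.image_subset_iff, Finset.mem_Icc, Finset.mem_Ioo]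
  rintro l ⟨hl, hlk⟩
  have hanti := hf.strictAntiOn
  have hl_mem : l ∈ Set.Iic (k + 1) := Set.mem_Iic.2 (hlk.trans k.le_succ)
  constructor
  · exact hf.d_last.symm.trans_lt (hanti hl_mem Set.self_mem_Iic (Nat.lt_succ_of_le hlk))
  · exact (hanti (Set.mem_Iic.2 (Nat.zero_le _)) hl_mem hl).trans_eq hf.d_zero

theorem exists_le_lt (hf : SeqOpt n k d f) {h : ℕ} (hh : h < n) :
    ∃ l ≤ k, d (l + 1) ≤ h ∧ h < d l := by
  set l := Nat.findGreatest (h < d ·) k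
  have hle : l ≤ k := Nat.findGreatest_le k
  have hfirst : h < d l :=
    Nat.findGreatest_spec (P := (h < d ·)) k.zero_le (hh.trans_eq hf.d_zero.symm)
  refine ⟨l, hle, not_lt.1 fun hlt => ?_, hfirst⟩
  rcases hle.eq_or_lt with heq | hlk
  · rw [heq, hf.d_last] at hlt
    exact Nat.not_lt_zero h hlt
  · exact Nat.findGreatest_is_greatest (P := (h < d ·)) l.lt_succ_self hlk hlt

theorem card_image_filter_le (hf : SeqOpt n k d f) {l h : ℕ} (hl : l ≤ k) (hle : d (l + 1) ≤ h)
    (hlt : h < d l) : ({j ∈ (Finset.Icc 1 k).image d | j ≤ h} : Finset ℕ).card = k - l := by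
  have hmem : ∀ i ≤ k + 1, i ∈ Set.Iic (k + 1) := fun i hi => hi
  have hiff : ∀ i ≤ k, (d i ≤ h ↔ l < i) := fun i hi =>
    ⟨fun hih => (hf.strictAntiOn.lt_iff_gt (hmem i (by omega)) (hmem l (by omega))).1
      (hih.trans_lt hlt),
    fun hli => (hf.strictAntiOn.antitoneOn (hmem (l + 1) (by omega)) (hmem i (by omega))
      hli).trans hle⟩
  have hfilter : {i ∈ Finset.Icc 1 k | d i ≤ h} = Finset.Ioc l k := by
    ext i
    have := hiff i
    simp only [Finset.mem_filter, Finset.mem_Icc, Finset.mem_Ioc]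
    grind
  have hsub : Finset.Ioc l k ⊆ Finset.Icc 1 k := hfilter ▸ Finset.filter_subset _ _
  rw [Finset.filter_image, hfilter,
    Finset.card_image_of_injOn (hf.injOn.mono (Finset.coe_subset.2 hsub)), Nat.card_Ioc]

theorem isGuidedBy (hf : SeqOpt n k d f) :
    IsGuidedBy f (alternatingOp ((Finset.Icc 1 k).image d)) := by
  intro h x hx y hy
  have hhn : h < n := Nat.lt_of_succ_le (hy.symm.trans_le (distOpt_le y))
  obtain ⟨l, hl, hle, hlt⟩ := hf.exists_le_lt hhn
  rw [alternatingOp, hf.card_image_filter_le hl hle hlt]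
  split_ifs with heven
  · exact hf.increasing l hl heven h hle hlt x hx y hy
  · exact hf.decreasing l hl (Nat.not_even_iff_odd.1 heven) h hle hlt x hx y hy

end SeqOpt

end SeqOpt

theorem mainTheorem1_general (K : ℕ) (c₁ c₂ : ℝ) (hc₁ : 0 < c₁) (hc₂ : 0 < c₂) :
    ∃ C : ℝ, 0 < C ∧ ∃ N : ℕ, ∀ n : ℕ, N ≤ n → ∀ p q : ℝ,
      c₁ * (1 / (n * Real.log n)) ≤ p → p ≤ c₂ * (1 / (n * Real.log n)) →
      c₁ * (1 / (n * Real.log n)) ≤ q → q ≤ c₂ * (1 / (n * Real.log n)) →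
      ∀ (g : ℕ → AcceptOp) (f : BitString n → ℝ), (turningDists n g).card ≤ K → IsGuidedBy f g →
        ∀ (Ω : Type*) [MeasurableSpace Ω] (μ : Measure Ω) [IsProbabilityMeasure μ]
          (X : ℕ → Ω → BitString n) (S : ℕ → Ω → AcceptOp),
          IsMarkovChain (mmahhTransition p q f) μ (fun t ω => (X t ω, S t ω)) →
          expectedRuntime μ X ≤ ENNReal.ofReal (C * ((n : ℝ) ^ ((turningDists n g).card + 1) /
            (∏ j ∈ turningDists n g, (j : ℝ)) * Real.log n)) := by
  refine ⟨4 ^ K * Real.exp (6 * c₂) / c₁, by positivity, max 3 ⌈4 * c₂⌉₊,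
    fun n hnN p q hp hp' hq hq' g f hK hfg Ω _ μ _ X S hZ => ?_⟩
  have hn3 : (3 : ℝ) ≤ n := by exact_mod_cast (le_max_left _ _).trans hnN
  have hn4 : 4 * c₂ ≤ n := Nat.ceil_le.1 ((le_max_right _ _).trans hnN)
  have hlog : 1 ≤ Real.log n :=
    (Real.le_log_iff_exp_le (by linarith)).2 (Real.exp_one_lt_three.le.trans hn3)
  have hn0 : (0 : ℝ) < n := by linarith
  have hlog0 : 0 < Real.log n := by linarith
  set ρ : ℝ := c₁ * (1 / (n * Real.log n)) with hρ
  set σ : ℝ := c₂ * (1 / (n * Real.log n)) with hσ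
  set D := turningDists n g
  have hσ_le : σ ≤ 1 / 4 := by
    rw [hσ, mul_one_div, div_le_iff₀ (by positivity)]
    nlinarith
  have hrate : ∀ s, switchRate p q s ∈ Set.Icc ρ σ
    | .OI => ⟨hp, hp'⟩
    | .OW => ⟨hq, hq'⟩
  have hlam : 3 * n * σ * (1 + Real.log n) ≤ 6 * c₂ := by
    have hσn : 3 * n * σ = 3 * c₂ / Real.log n := by rw [hσ]; field_simp
    rw [hσn, div_mul_eq_mul_div, div_le_iff₀ hlog0]
    nlinarith
  have hweight : (reachWeight n g (3 * n * σ) n)⁻¹ ≤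
      Real.exp (6 * c₂) * (4 ^ K * (n ^ D.card / ∏ j ∈ D, (j : ℝ))) := by
    refine (inv_reachWeight_le (by positivity)).trans ?_
    rw [mul_pow, mul_div_assoc]
    gcongr
    norm_num
  refine (hfg.expectedRuntime_le (by positivity) hrate hσ_le (by rintro rfl; norm_num at hn0)
    hZ).trans (ENNReal.ofReal_le_ofReal ?_)
  calc 1 / (ρ * reachWeight n g (3 * n * σ) n)
      = n * Real.log n / c₁ * (reachWeight n g (3 * n * σ) n)⁻¹ := by
        rw [one_div, mul_inv, hρ]
        field_simp
    _ ≤ n * Real.log n / c₁ *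
        (Real.exp (6 * c₂) * (4 ^ K * (n ^ D.card / ∏ j ∈ D, (j : ℝ)))) := by gcongr
    _ = _ := by ring

theorem mainTheorem1 (K : ℕ) (c₁ c₂ : ℝ) (hc₁ : 0 < c₁) (hc₂ : 0 < c₂) :
    ∃ C : ℝ, 0 < C ∧ ∃ N : ℕ, ∀ n : ℕ, N ≤ n →
      ∀ p q : ℝ, 0 < p → p < 1 → 0 < q → q < 1 →
        c₁ * (1 / (n * Real.log n)) ≤ p → p ≤ c₂ * (1 / (n * Real.log n)) →
        c₁ * (1 / (n * Real.log n)) ≤ q → q ≤ c₂ * (1 / (n * Real.log n)) →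
        ∀ (k : ℕ) (d : ℕ → ℕ) (f : BitString n → ℝ), k ≤ K → SeqOpt n k d f →
          ∀ (Ω : Type*) [MeasurableSpace Ω] (μ : MeasureTheory.Measure Ω)
            [MeasureTheory.IsProbabilityMeasure μ]
            (X : ℕ → Ω → BitString n) (S : ℕ → Ω → AcceptOp), IsMMAHHRun p q f μ X S →
            expectedRuntime μ X ≤
              ENNReal.ofReal (C * ((n : ℝ) ^ (k + 1) / (∏ l ∈ Finset.Icc 1 k, (d l : ℝ)) *
                Real.log n)) := by
  obtain ⟨C, hC, N, hbound⟩ := mainTheorem1_general K c₁ c₂ hc₁ hc₂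
  refine ⟨C, hC, N, fun n hn p q _ _ _ _ hp hp' hq hq' k d f hk hf Ω _ μ _ X S hrun => ?_⟩
  have hD := turningDists_alternatingOp hf.image_subset_Ioo
  have hcard : ((Finset.Icc 1 k).image d).card = k := by
    rw [Finset.card_image_of_injOn hf.injOn, Nat.card_Icc, Nat.add_sub_cancel]
  have hruntime := hbound n hn p q hp hp' hq hq' _ f (by rwa [hD, hcard]) hf.isGuidedBy Ω μ X S
    hrun.isMarkovChain
  rwa [hD, hcard, Finset.prod_image hf.injOn] at hruntime
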